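/- Let $A$ be a finite-dimensional associative algebra, not necessarily unital, over a field $F$ with $\operatorname{char}(F)\neq 2$. Let $[A,A]$ denote the linear span of all commutators $[x,y]=xy-yx$ with $x,y\in A$, and let $\operatorname{rad}(A)$ denote the radical of $A$, i.e. the unique maximal nilpotent two-sided ideal of $A$. If a linear map $D:A\to A$ satisfies $xD(x)x\in[A,A]$ for every $x\in A$, then $D$ is the sum of an inner derivation of $A$ and a linear map from $A$ to $\operatorname{rad}(A)$; that is, there exist $a\in A$ and a linear map $N:A\to A$ with $N(A)\subseteq\operatorname{rad}(A)$ such that $D(x)=[a,x]+N(x)$ for all $x\in A$. -/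

import Mathlib

namespace AssocAlg

/-! Algebras are associative but need not have a unit: they are rings `A` of class `NonUnitalRing`
with compatible scalar multiplication by the field `F`. -/

section Defs

variable (F : Type*) {A : Type*} [Field F] [NonUnitalRing A] [Module F A]

/-- `[A, A]`: the linear span of all commutators `xy - yx`. -/
def commutatorSpan (A : Type*) [NonUnitalRing A] [Module F A] : Submodule F A :=
  Submodule.span F {z | ∃ x y : A, z = x * y - y * x}

/-- The inner derivation `x ↦ [a, x] = ax - xa`. -/
def innerDerivation [IsScalarTower F A A] [SMulCommClass F A A] (a : A) : A →ₗ[F] A :=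
  LinearMap.mulLeft F a - LinearMap.mulRight F a

variable {F}

/-- Two-sided ideals of an algebra (in particular, linear subspaces). -/
def IsIdeal (I : Submodule F A) : Prop :=
  ∀ x ∈ I, ∀ a : A, a * x ∈ I ∧ x * a ∈ I

/-- A nilpotent subspace: for some `n`, every product `b₀ b₁ ⋯ bₙ` of `n + 1` of its elements
is zero. -/
def IsNilp (I : Submodule F A) : Prop :=
  ∃ n : ℕ, ∀ b ∈ I, ∀ l : List A, l.length = n → (∀ c ∈ l, c ∈ I) → l.foldl (· * ·) b = 0

variable (F)

/-- The radical: the largest nilpotent two-sided ideal, defined as the sum of all nilpotent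
two-sided ideals (see `isGreatest_radical`). -/
def radical (A : Type*) [NonUnitalRing A] [Module F A] : Submodule F A :=
  sSup {I : Submodule F A | IsIdeal I ∧ IsNilp I}

end Defs

section Facts

variable {F A : Type*} [Field F] [NonUnitalRing A] [Module F A]

theorem foldl_add (l : List A) (x y : A) :
    l.foldl (· * ·) (x + y) = l.foldl (· * ·) x + l.foldl (· * ·) y := by
  induction l generalizing x y with
  | nil => rfl
  | cons u l ih => simp only [List.foldl_cons, add_mul, ih]

theorem foldl_zero (l : List A) : l.foldl (· * ·) (0 : A) = 0 := by
  induction l with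
  | nil => rfl
  | cons u l ih => simpa only [List.foldl_cons, zero_mul] using ih

theorem foldl_mul_eq_zero {I : Submodule F A} (hI : IsIdeal I) {k : ℕ} {x : A}
    (hx : ∀ l : List A, l.length = k → (∀ c ∈ l, c ∈ I) → l.foldl (· * ·) x = 0)
    (y : A) (l : List A) (hl : l.length = k) (hc : ∀ c ∈ l, c ∈ I) :
    l.foldl (· * ·) (x * y) = 0 := by
  cases l with
  | nil =>
    have h0 : x = 0 := hx [] hl hc
    simp [h0]
  | cons u l =>
    have := hx ((y * u) :: l) (by simpa using hl) (by
      intro c h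
      rcases List.mem_cons.1 h with rfl | h
      · exact (hI u (hc u (by simp)) y).1
      · exact hc c (by simp [h]))
    simpa [mul_assoc] using this

theorem foldl_sup_eq_zero {I J : Submodule F A} (hI : IsIdeal I) (hJ : IsIdeal J) (l : List A) :
    ∀ (a b : ℕ) (x : A), l.length = a + b → (∀ c ∈ l, c ∈ I ⊔ J) →
    (∀ l : List A, l.length = a → (∀ c ∈ l, c ∈ I) → l.foldl (· * ·) x = 0) →
    (∀ l : List A, l.length = b → (∀ c ∈ l, c ∈ J) → l.foldl (· * ·) x = 0) →
    l.foldl (· * ·) x = 0 := by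
  induction l with
  | nil =>
    intro a b x hl _ ha _
    have : a = 0 := by simp at hl; omega
    subst this
    exact ha [] rfl (by simp)
  | cons u l ih =>
    intro a b x hl hc ha hb
    rcases a with _ | a
    · have h0 : x = 0 := ha [] rfl (by simp)
      rw [h0, foldl_zero]
    rcases b with _ | b
    · have h0 : x = 0 := hb [] rfl (by simp)
      rw [h0, foldl_zero]
    obtain ⟨i, hi, j, hj, rfl⟩ := Submodule.mem_sup.1 (hc u (by simp))
    simp only [List.length_cons] at hl
    rw [List.foldl_cons, mul_add, foldl_add,
      ih a (b + 1) (x * i) (by omega) (fun c h => hc c (by simp [h]))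
        (fun m hm hmc => ha (i :: m) (by simp [hm]) (by simpa [hi] using hmc))
        (foldl_mul_eq_zero hJ hb i),
      ih (a + 1) b (x * j) (by omega) (fun c h => hc c (by simp [h]))
        (foldl_mul_eq_zero hI ha j)
        (fun m hm hmc => hb (j :: m) (by simp [hm]) (by simpa [hj] using hmc)), add_zero]

theorem IsNilp.foldl_eq_zero {I : Submodule F A} (hI : IsIdeal I) (h : IsNilp I) :
    ∃ n : ℕ, ∀ (x : A) (l : List A), l.length = n → (∀ c ∈ l, c ∈ I) →
      l.foldl (· * ·) x = 0 := by
  obtain ⟨n, hn⟩ := h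
  refine ⟨n + 1, fun x l hl hc => ?_⟩
  cases l with
  | nil => simp at hl
  | cons u l =>
    exact hn (x * u) (hI u (hc u (by simp)) x).1 l (by simpa using hl)
      (fun c h => hc c (by simp [h]))

/-- In a finite-dimensional algebra `radical F A` is the largest nilpotent two-sided ideal. -/
theorem isGreatest_radical (F A : Type*) [Field F] [NonUnitalRing A] [Module F A]
    [FiniteDimensional F A] :
    IsGreatest {I : Submodule F A | IsIdeal I ∧ IsNilp I} (radical F A) := by
  refine ⟨?_, fun I hI => le_sSup hI⟩
  refine CompleteLattice.WellFoundedGT.isSupClosedCompact (Submodule F A) inferInstance _ ?_ ?_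
  · refine ⟨⊥, ?_, 0, ?_⟩
    · intro x hx a
      simp [(Submodule.mem_bot F).1 hx]
    · intro b hb l _ _
      rw [(Submodule.mem_bot F).1 hb, foldl_zero]
  · rintro I ⟨hI, hIn⟩ J ⟨hJ, hJn⟩
    refine ⟨?_, ?_⟩
    · intro x hx a
      obtain ⟨i, hi, j, hj, rfl⟩ := Submodule.mem_sup.1 hx
      rw [mul_add, add_mul]
      exact ⟨Submodule.add_mem_sup (hI i hi a).1 (hJ j hj a).1,
        Submodule.add_mem_sup (hI i hi a).2 (hJ j hj a).2⟩
    · obtain ⟨n, hn⟩ := hIn.foldl_eq_zero hI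
      obtain ⟨m, hm⟩ := hJn.foldl_eq_zero hJ
      exact ⟨n + m, fun x _ l hl hc => foldl_sup_eq_zero hI hJ l n m x hl hc (hn x) (hm x)⟩

end Facts

end AssocAlg

/-!
Let `R` be the unitization of `A` and `J` its Jacobson radical. `R ⧸ J` is a finite product of matrix
algebras `Bᵢ` over division algebras, the image of the ideal `A` in each `Bᵢ` is zero or everything,
and `A ∩ J` is a nilpotent ideal of `A`, hence contained in the radical. It therefore suffices to
show that modulo the kernel of each surjection `π : A → B = Bᵢ` the map `D` acts as an inner
derivation (`exists_inner_of_surjective_matrix`): the elements implementing these derivations are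
images of a single `a : A`, and `D - [a, ·]` maps into `A ∩ J`.

For simple `B` with centre `K`, put `L = AlgebraicClosure K`. Then `L ⊗[K] B` is a full matrix
algebra, and the matrix trace restricts to a `K`-linear `T : B → L` which kills commutators and makes
`(x, y) ↦ T (x y)` nondegenerate (`eq_zero_of_splitTrace_mul_eq_zero`). Polarizing the cubic identity
`T (x D(x) x) = 0` needs only `2 ≠ 0` and gives
`T ((D(x) x + x D(x)) y) + T (x² D(y)) = 0` (`trace_polarization`). As squares span `B`, this shows
that `D` preserves `ker π` and that the induced map on `B` is `K`-linear.

Everything then extends to `L ⊗[K] B`, that is, to matrices over `L`. There `T (e D(e) e) = 0` for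
idempotents `e` yields `T (e D(1)) = 0`, so `D 1 = 0`; hence `D` is skew-adjoint for the trace form,
and the polarized identity says that `D` is a Jordan derivation (`Matrix.jordan_of_trace_eq_zero`).
Evaluating on matrix units shows that it is inner (`Matrix.exists_inner_of_trace_eq_zero`), and a
`K`-linear retraction `L → K` brings the implementing element back to `B`
(`exists_inner_of_splitTrace_eq_zero`).
-/

/-! ### Polarization of the cubic trace identity -/

section Polarization

variable {R G : Type*} [NonUnitalRing R] [AddCommGroup G]

/-- Only absence of 2-torsion is needed: subtracting the identities for `x + y` and `x - y` isolates
twice the part quadratic in `x` and linear in `y`, up to a multiple of the identity for `y`. -/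
theorem trace_polarization (hG : ∀ g : G, g + g = 0 → g = 0) (t : R →+ G)
    (ht : ∀ x y, t (x * y) = t (y * x)) (D : R →+ R) (hD : ∀ x, t (x * D x * x) = 0) (x y : R) :
    t ((D x * x + x * D x) * y) + t (x * x * D y) = 0 := by
  have h1 := hD (x + y)
  have h2 := hD (x - y)
  have h3 : t (y * D x * x) = t (D x * x * y) := by rw [mul_assoc, ht]
  have h4 : t (x * D y * x) = t (x * x * D y) := by rw [ht, mul_assoc]
  simp only [map_add, map_sub, add_mul, mul_add, sub_mul, mul_sub, hD, h3, h4] at h1 h2 ⊢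
  apply hG
  have := congrArg₂ (· - ·) h1 h2
  simp only [sub_zero] at this
  rw [← this]
  abel

/-- The trilinear form of `trace_polarization`; unlike the latter it survives extension of scalars. -/
theorem trace_polarization₂ (hG : ∀ g : G, g + g = 0 → g = 0) (t : R →+ G)
    (ht : ∀ x y, t (x * y) = t (y * x)) (D : R →+ R) (hD : ∀ x, t (x * D x * x) = 0)
    (x y z : R) :
    t ((D x * y + x * D y + (D y * x + y * D x)) * z) + t ((x * y + y * x) * D z) = 0 := by
  have h1 := trace_polarization hG t ht D hD (x + y) z
  have h2 := trace_polarization hG t ht D hD x z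
  have h3 := trace_polarization hG t ht D hD y z
  have := congrArg₂ (· - ·) h1 (congrArg₂ (· + ·) h2 h3)
  simp only [map_add, add_mul, mul_add, sub_zero, add_zero] at this ⊢
  rw [← this]
  abel

end Polarization

/-! ### Full matrix algebras over a field -/

section MatrixAlgebra

open Matrix

variable {L n : Type*} [Field L] [Fintype n] [DecidableEq n]

theorem Matrix.eq_zero_of_forall_idempotent_trace_eq_zero (c : Matrix n n L)
    (hc : ∀ e : Matrix n n L, e * e = e → trace (e * c) = 0) : c = 0 := by
  have h1 : ∀ i, c i i = 0 := fun i => by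
    simpa [trace_single_mul] using hc (single i i 1) (by simp)
  ext j i
  rcases eq_or_ne i j with rfl | hij
  · simpa using h1 i
  · have := hc (single i i 1 + single i j 1) (by
      simp [add_mul, mul_add, hij.symm])
    simpa [add_mul, trace_single_mul, h1 i] using this

/-- `D` is a Jordan derivation: `D 1 = 0`, so `D` is skew-adjoint for the trace form, which turns
the polarized identity into the Jordan identity. -/
theorem Matrix.jordan_of_trace_eq_zero (h2 : (2 : L) ≠ 0) (D : Matrix n n L →ₗ[L] Matrix n n L)
    (hD : ∀ x, trace (x * D x * x) = 0) (x y : Matrix n n L) :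
    D (x * y + y * x) = D x * y + x * D y + (D y * x + y * D x) := by
  have hG : ∀ g : L, g + g = 0 → g = 0 := fun g hg => by
    rw [← two_mul] at hg
    exact (mul_eq_zero.1 hg).resolve_left h2
  have P := trace_polarization hG (traceAddMonoidHom n L) trace_mul_comm D.toAddMonoidHom hD
  have P₂ := trace_polarization₂ hG (traceAddMonoidHom n L) trace_mul_comm D.toAddMonoidHom hD
  simp only [traceAddMonoidHom_apply, LinearMap.toAddMonoidHom_coe] at P P₂
  -- for an idempotent `e`, all of `tr (e * D e)`, `tr (D e * e)` and `tr (e * D e * e)` agree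
  have hone : D 1 = 0 := by
    apply eq_zero_of_forall_idempotent_trace_eq_zero
    intro e he
    have h3 := P e 1
    have h4 : trace (e * D e) = 0 := by
      have := hD e
      rwa [trace_mul_comm, ← mul_assoc, he] at this
    rwa [mul_one, trace_add, trace_mul_comm (D e), h4, he, add_zero, zero_add] at h3
  have hskew : ∀ u v, trace (D u * v) = - trace (u * D v) := by
    intro u v
    have h3 := P₂ u v 1
    rw [hone, mul_zero, trace_zero, add_zero, mul_one] at h3
    simp only [trace_add] at h3
    rw [trace_mul_comm (D v), trace_mul_comm v] at h3
    rw [eq_neg_iff_add_eq_zero]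
    apply hG
    rw [← h3]
    ring
  apply ext_iff_trace_mul_right.2
  intro z
  rw [hskew, neg_eq_iff_add_eq_zero, add_comm]
  exact P₂ x y z

/-- A Jordan derivation which kills the diagonal matrix units scales every matrix unit, the scalars
`cᵢⱼ` satisfy `cᵢⱼ + cⱼₖ = cᵢₖ`, and so the diagonal matrix with entries `cᵢₛ`, for any fixed `s`,
implements it. -/
theorem Matrix.exists_inner_of_jordan_of_single_eq_zero (h2 : (2 : L) ≠ 0)
    (D : Matrix n n L →ₗ[L] Matrix n n L)
    (hD : ∀ x y, D (x * y + y * x) = D x * y + x * D y + (D y * x + y * D x))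
    (h0 : ∀ i, D (single i i 1) = 0) : ∃ a : Matrix n n L, ∀ x, D x = a * x - x * a := by
  have hE : ∀ i j, D (single i j 1) = single i j (D (single i j 1) i j) := by
    intro i j
    rcases eq_or_ne i j with rfl | hij
    · simp [h0]
    -- `Eᵢⱼ` is the Jordan product of itself with `Eᵢᵢ` and with `Eⱼⱼ`, and has square zero; the first
    -- two facts leave only the entries `(i, j)` and `(j, i)` of `D Eᵢⱼ`, the third kills `(j, i)`
    have h3 := hD (single i i 1) (single i j 1)
    have h4 := hD (single j j 1) (single i j 1)
    have h5 := hD (single i j 1) (single i j 1)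
    simp only [single_mul_single_same, single_mul_single_of_ne _ _ _ _ hij.symm, h0, mul_one,
      add_zero, zero_add, mul_zero, zero_mul, map_zero] at h3 h4 h5
    ext k l
    have e3 := congrFun₂ h3 k l
    have e4 := congrFun₂ h4 k l
    have e5 := congrFun₂ h5 i i
    generalize D (single i j 1) = X at e3 e4 e5 ⊢
    simp only [Matrix.add_apply, Matrix.mul_apply, single_apply, ite_and, ite_mul, mul_ite, one_mul,
      mul_one, zero_mul, mul_zero, Finset.sum_ite_eq, Finset.sum_ite_irrel, Finset.sum_const_zero,
      Finset.mem_univ, if_true, Matrix.zero_apply] at e3 e4 e5 ⊢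
    grind
  have hadd : ∀ i j k, D (single i j 1) i j + D (single j k 1) j k = D (single i k 1) i k := by
    intro i j k
    rcases eq_or_ne i k with rfl | hik
    · rcases eq_or_ne i j with rfl | hij
      · simp [h0]
      · have h3 := hD (single i j 1) (single j i 1)
        rw [hE i j, hE j i] at h3
        have e3 := congrFun₂ h3 i i
        simpa [h0, hij, hij.symm, eq_comm] using e3
    · have h3 := hD (single i j 1) (single j k 1)
      rw [hE i j, hE j k] at h3
      have e3 := congrFun₂ h3 i k
      simpa [hik, hik.symm, eq_comm] using e3
  rcases isEmpty_or_nonempty n with hn | ⟨⟨i₀⟩⟩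
  · exact ⟨0, fun x => Subsingleton.elim _ _⟩
  refine ⟨diagonal fun i => D (single i i₀ 1) i i₀, fun x => ?_⟩
  suffices D = LinearMap.mulLeft L (diagonal fun i => D (single i i₀ 1) i i₀) -
      LinearMap.mulRight L (diagonal fun i => D (single i i₀ 1) i i₀) by
    simpa using LinearMap.congr_fun this x
  refine Matrix.ext_linearMap _ fun i j => LinearMap.ext_ring ?_
  change D (single i j 1) = diagonal _ * single i j 1 - single i j 1 * diagonal _
  rw [hE i j, ← hadd i i₀ j]
  have := hadd j i₀ j
  rw [h0, Matrix.zero_apply] at this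
  ext k l
  simp only [Matrix.sub_apply, diagonal_mul, mul_diagonal, single_apply]
  grind

/-- As `D` is a Jordan derivation, it suffices to correct it by an inner derivation so that it kills
the diagonal matrix units. -/
theorem Matrix.exists_inner_of_trace_eq_zero (h2 : (2 : L) ≠ 0)
    (D : Matrix n n L →ₗ[L] Matrix n n L) (hD : ∀ x, trace (x * D x * x) = 0) :
    ∃ a : Matrix n n L, ∀ x, D x = a * x - x * a := by
  have J := jordan_of_trace_eq_zero h2 D hD
  have hE : ∀ i, D (single i i 1) = single i i 1 * D (single i i 1) +
      D (single i i 1) * single i i 1 := fun i => by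
    have h := J (single i i 1) (single i i 1)
    simp only [single_mul_single_same, mul_one, ← two_smul L, map_smul] at h
    rw [add_comm]
    exact smul_right_injective _ h2 h
  -- orthogonality of `Eᵢᵢ` and `Eⱼⱼ` for `i ≠ j`; for `i = j` both sides vanish
  have hEE : ∀ i j, single j j 1 * D (single i i 1) * single i i 1 =
      - (single j j 1 * D (single j j 1) * single i i 1) := by
    intro i j
    rcases eq_or_ne i j with rfl | hij
    · have h : single i i 1 * D (single i i 1) * single i i 1 = 0 := by
        have h := congrArg (fun X => single i i 1 * X * single i i 1) (hE i)
        simpa [mul_add, add_mul, mul_assoc, ← mul_assoc (single i i (1 : L)) (single i i 1)] using h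
      rw [h, neg_zero]
    · have h := congrArg (fun X => single j j 1 * X * single i i 1) (J (single i i 1) (single j j 1))
      simp only [single_mul_single_of_ne _ _ _ _ hij, single_mul_single_of_ne _ _ _ _ hij.symm,
        add_zero, map_zero, mul_zero, zero_mul, mul_add, add_mul, mul_assoc,
        single_mul_single_same, mul_one] at h
      simp only [← mul_assoc, single_mul_single_of_ne _ _ _ _ hij.symm, single_mul_single_same,
        mul_one, zero_mul, add_zero, zero_add] at h
      rw [eq_neg_iff_add_eq_zero, add_comm, ← h]
  -- `[a₀, ·]` agrees with `D` on the diagonal matrix units, so their difference kills these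
  let a₀ : Matrix n n L := ∑ i, D (single i i 1) * single i i 1
  obtain ⟨a, ha⟩ := exists_inner_of_jordan_of_single_eq_zero h2
    (D - (LinearMap.mulLeft L a₀ - LinearMap.mulRight L a₀)) (fun x y => by
      simp only [LinearMap.sub_apply, LinearMap.mulLeft_apply, LinearMap.mulRight_apply, J]
      noncomm_ring) (fun j => by
      simp only [LinearMap.sub_apply, LinearMap.mulLeft_apply, LinearMap.mulRight_apply]
      have hl : a₀ * single j j 1 = D (single j j 1) * single j j 1 := by
        simp only [a₀, Finset.sum_mul, mul_assoc]
        rw [Finset.sum_eq_single j (fun i _ hij => by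
          rw [single_mul_single_of_ne _ _ _ _ hij, mul_zero]) (by simp)]
        simp
      have hr : single j j 1 * a₀ = - (single j j 1 * D (single j j 1)) := by
        simp only [a₀, Finset.mul_sum, ← mul_assoc, hEE]
        rw [Finset.sum_neg_distrib, ← Finset.mul_sum, sum_single_one, mul_one]
      rw [hl, hr, sub_neg_eq_add, add_comm (D _ * _), ← hE, sub_self])
  refine ⟨a₀ + a, fun x => ?_⟩
  have := ha x
  simp only [LinearMap.sub_apply, LinearMap.mulLeft_apply, LinearMap.mulRight_apply] at this
  rw [← sub_eq_zero] at this ⊢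
  rw [← this]
  noncomm_ring

end MatrixAlgebra

/-! ### Splitting of central simple algebras -/

section CentralSimple

open TensorProduct

/-- A nonzero element of a two-sided ideal of `L ⊗ B` whose coordinates along a basis of `L` have
minimal support can be normalized to have one coordinate equal to `1`; by minimality it then commutes
with `1 ⊗ B`, so it lies in `L ⊗ 1` and is invertible. -/
theorem isSimpleRing_tensorProduct (K L B : Type*) [Field K] [Field L] [Ring B] [Algebra K L]
    [Algebra K B] [IsSimpleRing B] [Algebra.IsCentral K B] : IsSimpleRing (L ⊗[K] B) := by
  classical
  let ℬ := Module.Basis.ofVectorSpace K L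
  let c := TensorProduct.equivFinsuppOfBasisLeft (N := B) ℬ
  -- left and right multiplication by `1 ⊗ b` acts coordinatewise
  have hl : ∀ (b : B) (X : L ⊗[K] B) i, c ((1 ⊗ₜ b) * X) i = b * c X i := by
    intro b X i
    induction X using TensorProduct.induction_on with
    | zero => simp
    | tmul l y => simp [c]
    | add X Y hX hY => simp only [mul_add, map_add, Finsupp.add_apply, hX, hY]
  have hr : ∀ (b : B) (X : L ⊗[K] B) i, c (X * (1 ⊗ₜ b)) i = c X i * b := by
    intro b X i
    induction X using TensorProduct.induction_on with
    | zero => simp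
    | tmul l y => simp [c]
    | add X Y hX hY => simp only [add_mul, map_add, Finsupp.add_apply, hX, hY]
  refine .of_eq_bot_or_eq_top fun J => ?_
  rw [or_iff_not_imp_left]
  intro hJ
  have hex : ∃ m, ∃ X ∈ J, X ≠ 0 ∧ (c X).support.card = m := by
    by_contra h
    push Not at h
    refine hJ (le_bot_iff.1 fun X hX => ?_)
    by_contra hX0
    exact h _ X hX hX0 rfl
  obtain ⟨X, hXJ, hX0, hXm⟩ := Nat.find_spec hex
  have hmin : ∀ Y ∈ J, (c Y).support.card < (c X).support.card → Y = 0 := by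
    intro Y hY hlt
    by_contra hY0
    exact Nat.find_min hex (hXm ▸ hlt) ⟨Y, hY, hY0, rfl⟩
  have hcX : c X ≠ 0 := by simpa using hX0
  obtain ⟨i₀, hi₀⟩ := Finsupp.ne_iff.1 hcX
  rw [Finsupp.zero_apply] at hi₀
  -- the `i₀`-th coordinates of elements of `J` supported in the support of `X` form an ideal
  let I : TwoSidedIdeal B := .mk' {b | ∃ Y ∈ J, (c Y).support ⊆ (c X).support ∧ c Y i₀ = b}
    ⟨0, J.zero_mem, by simp, by simp⟩
    (by
      rintro _ _ ⟨Y, hY, hYs, rfl⟩ ⟨Z, hZ, hZs, rfl⟩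
      refine ⟨Y + Z, J.add_mem hY hZ, ?_, by simp⟩
      rw [map_add]
      exact Finsupp.support_add.trans (Finset.union_subset hYs hZs))
    (by
      rintro _ ⟨Y, hY, hYs, rfl⟩
      exact ⟨-Y, J.neg_mem hY, by simpa using hYs, by simp⟩)
    (by
      rintro b _ ⟨Y, hY, hYs, rfl⟩
      refine ⟨_, J.mul_mem_left (1 ⊗ₜ b) _ hY, fun i hi => hYs ?_, hl _ _ _⟩
      rw [Finsupp.mem_support_iff, hl] at hi
      exact Finsupp.mem_support_iff.2 (right_ne_zero_of_mul hi))
    (by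
      rintro _ b ⟨Y, hY, hYs, rfl⟩
      refine ⟨_, J.mul_mem_right _ (1 ⊗ₜ b) hY, fun i hi => hYs ?_, hr _ _ _⟩
      rw [Finsupp.mem_support_iff, hr] at hi
      exact Finsupp.mem_support_iff.2 (left_ne_zero_of_mul hi))
  have h1 : (1 : B) ∈ I := IsSimpleRing.one_mem_of_ne_zero_mem I hi₀
    ((TwoSidedIdeal.mem_mk' ..).2 ⟨X, hXJ, subset_rfl, rfl⟩)
  obtain ⟨Y, hYJ, hYs, hY1⟩ := (TwoSidedIdeal.mem_mk' ..).1 h1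
  -- `Y` commutes with every `1 ⊗ b`, since the commutator has smaller support
  have hcomm : ∀ b i, b * c Y i = c Y i * b := by
    intro b i
    have h0 : (1 ⊗ₜ b) * Y - Y * (1 ⊗ₜ b) = 0 := by
      refine hmin _ (J.sub_mem (J.mul_mem_left _ _ hYJ) (J.mul_mem_right _ _ hYJ))
        (Finset.card_lt_card ((Finset.ssubset_iff_of_subset fun j hj => hYs ?_).2
          ⟨i₀, Finsupp.mem_support_iff.2 hi₀, ?_⟩))
      · rw [Finsupp.mem_support_iff, map_sub, Finsupp.sub_apply, hl, hr] at hj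
        rw [Finsupp.mem_support_iff]
        intro h0
        simp [h0] at hj
      · rw [Finsupp.notMem_support_iff, map_sub, Finsupp.sub_apply, hl, hr, hY1]
        simp
    have := congrArg (fun Z => c Z i) h0
    simp only [map_sub, Finsupp.sub_apply, hl, hr, map_zero, Finsupp.zero_apply] at this
    exact sub_eq_zero.1 this
  have hcen : ∀ i, ∃ k : K, c Y i = algebraMap K B k := fun i =>
    (Algebra.IsCentral.mem_center_iff K).1
      (Subalgebra.mem_center_iff.2 fun b => hcomm b i)
  have hYl : ∃ l : L, Y = l ⊗ₜ 1 := by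
    choose k hk using hcen
    refine ⟨(c Y).sum fun i _ => k i • ℬ i, ?_⟩
    conv_lhs => rw [← c.symm_apply_apply Y, TensorProduct.equivFinsuppOfBasisLeft_symm_apply]
    simp only [Finsupp.sum, TensorProduct.sum_tmul, 
      TensorProduct.smul_tmul, hk, Algebra.algebraMap_eq_smul_one]
  obtain ⟨l, rfl⟩ := hYl
  have hl0 : l ≠ 0 := by
    rintro rfl
    simp at hY1
  rw [← TwoSidedIdeal.one_mem_iff]
  have := J.mul_mem_left (l⁻¹ ⊗ₜ 1) _ hYJ
  rwa [Algebra.TensorProduct.tmul_mul_tmul, inv_mul_cancel₀ hl0, one_mul] at this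

variable {K B : Type*} [Field K] [Ring B] [Algebra K B]

theorem exists_splitting (K B : Type*) [Field K] [Ring B] [Algebra K B] [IsSimpleRing B]
    [Algebra.IsCentral K B] [FiniteDimensional K B] :
    ∃ (n : ℕ) (_ : NeZero n), Nonempty (AlgebraicClosure K ⊗[K] B ≃ₐ[AlgebraicClosure K]
      Matrix (Fin n) (Fin n) (AlgebraicClosure K)) :=
  have := isSimpleRing_tensorProduct K (AlgebraicClosure K) B
  IsSimpleRing.exists_algEquiv_matrix_of_isAlgClosed _ _

variable {L : Type*} [Field L] [Algebra K L] {n : Type*} [Fintype n] [DecidableEq n]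
  (φ : L ⊗[K] B ≃ₐ[L] Matrix n n L)

/-- The trace on `B` attached to a splitting `φ` of `L ⊗ B`: the matrix trace of `φ (1 ⊗ b)`, with
values in `L`. For central simple `B` this is the reduced trace, but the fact that its values lie in
`K` is not needed. -/
def splitTrace : B →ₗ[K] L :=
  (Matrix.traceLinearMap n L L).restrictScalars K ∘ₗ φ.toLinearMap.restrictScalars K ∘ₗ
    (Algebra.TensorProduct.includeRight : B →ₐ[K] L ⊗[K] B).toLinearMap

theorem splitTrace_apply (b : B) : splitTrace φ b = Matrix.trace (φ (1 ⊗ₜ b)) := rfl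

theorem splitTrace_mul_comm (x y : B) : splitTrace φ (x * y) = splitTrace φ (y * x) := by
  have h : ∀ x y : B, (1 : L) ⊗ₜ[K] (x * y) = (1 ⊗ₜ x) * (1 ⊗ₜ y) := by simp
  rw [splitTrace_apply, splitTrace_apply, h, h, map_mul, map_mul, Matrix.trace_mul_comm]

/-- The trace form is nondegenerate, as the trace form on matrices is and `1 ⊗ B` spans `L ⊗ B`. -/
theorem eq_zero_of_splitTrace_mul_eq_zero (b : B) (hb : ∀ y, splitTrace φ (y * b) = 0) :
    b = 0 := by
  have h1 : ∀ X : L ⊗[K] B, Matrix.trace (φ (X * (1 ⊗ₜ b))) = 0 := by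
    intro X
    induction X using TensorProduct.induction_on with
    | zero => simp
    | tmul l y =>
      have : (l ⊗ₜ[K] y) * (1 ⊗ₜ b) = l • ((1 : L) ⊗ₜ[K] (y * b)) := by
        simp [TensorProduct.smul_tmul']
      rw [this, map_smul, Matrix.trace_smul, ← splitTrace_apply, hb, smul_zero]
    | add X Y hX hY => rw [add_mul, map_add, Matrix.trace_add, hX, hY, add_zero]
  have h2 : φ (1 ⊗ₜ b) = 0 := by
    apply Matrix.ext_iff_trace_mul_left.2
    intro x
    rw [mul_zero, Matrix.trace_zero, ← h1 (φ.symm x)]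
    simp
  have h3 : (1 : L) ⊗ₜ[K] b = 0 := by simpa using h2
  exact Algebra.TensorProduct.includeRight_injective (A := L) (algebraMap K L).injective
    (by simpa using h3)

/-- A map `D` on a split algebra with `tr (x D(x) x) = 0` is inner: its extension to matrices over `L`
is, and the implementing matrix is carried back to `B` by a retraction of `K → L`. -/
theorem exists_inner_of_splitTrace_eq_zero (h2 : (2 : L) ≠ 0) (D : B →ₗ[K] B)
    (hD : ∀ x, splitTrace φ (x * D x * x) = 0) : ∃ a : B, ∀ x, D x = a * x - x * a := by
  have hG : ∀ g : L, g + g = 0 → g = 0 := fun g hg => by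
    rw [← two_mul] at hg
    exact (mul_eq_zero.1 hg).resolve_left h2
  have P₂ := trace_polarization₂ hG (splitTrace φ).toAddMonoidHom (splitTrace_mul_comm φ)
    D.toAddMonoidHom hD
  simp only [LinearMap.toAddMonoidHom_coe] at P₂
  let DL : L ⊗[K] B →ₗ[L] L ⊗[K] B := D.baseChange L
  let t : L ⊗[K] B →ₗ[L] L := Matrix.traceLinearMap n L L ∘ₗ φ.toLinearMap
  have ht : ∀ l b, t (l ⊗ₜ b) = l * splitTrace φ b := by
    intro l b
    have : l ⊗ₜ[K] b = l • ((1 : L) ⊗ₜ[K] b) := by simp [TensorProduct.smul_tmul']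
    rw [this, map_smul, smul_eq_mul]
    rfl
  have htc : ∀ X Y, t (X * Y) = t (Y * X) := fun X Y => by
    change Matrix.trace (φ _) = Matrix.trace (φ _)
    rw [map_mul, map_mul, Matrix.trace_mul_comm]
  have hP : ∀ X Y Z, t ((DL X * Y + X * DL Y + (DL Y * X + Y * DL X)) * Z) +
      t ((X * Y + Y * X) * DL Z) = 0 := by
    intro X Y Z
    induction X using TensorProduct.induction_on with
    | zero => simp
    | add X X' hX hX' =>
      have := congrArg₂ (· + ·) hX hX'
      simp only [map_add, add_mul, mul_add, add_zero] at this ⊢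
      rw [← this]
      abel
    | tmul l x =>
    induction Y using TensorProduct.induction_on with
    | zero => simp
    | add X X' hX hX' =>
      have := congrArg₂ (· + ·) hX hX'
      simp only [map_add, add_mul, mul_add, add_zero] at this ⊢
      rw [← this]
      abel
    | tmul l' y =>
    induction Z using TensorProduct.induction_on with
    | zero => simp
    | add X X' hX hX' =>
      have := congrArg₂ (· + ·) hX hX'
      simp only [map_add, add_mul, mul_add, add_zero] at this ⊢
      rw [← this]
      abel
    | tmul l'' z =>
      have := congrArg (fun u => l * l' * l'' * u) (P₂ x y z)
      simp only [DL, LinearMap.baseChange_tmul, Algebra.TensorProduct.tmul_mul_tmul, add_mul,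
        map_add, ht, mul_add] at this ⊢
      rw [mul_zero] at this
      rw [← this]
      ring
  -- the cubic identity holds on pure tensors, and by `hP` its mixed terms in `X + Y` vanish
  have hc : ∀ X, t (X * DL X * X) = 0 := by
    intro X
    induction X using TensorProduct.induction_on with
    | zero => simp
    | tmul l x =>
      simp only [DL, LinearMap.baseChange_tmul, Algebra.TensorProduct.tmul_mul_tmul, ht, hD,
        mul_zero]
    | add X Y hX hY =>
      have key : ∀ X Y, t (Y * DL X * X) + t (X * DL Y * X) + t (X * DL X * Y) = 0 := by
        intro X Y
        have h := hP X X Y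
        apply hG
        rw [mul_assoc Y, htc Y, htc (X * DL Y), ← mul_assoc, ← h]
        simp only [add_mul, map_add]
        abel
      have h1 := key X Y
      have h2 := key Y X
      simp only [map_add, add_mul, mul_add, hX, hY, zero_add, add_zero]
      linear_combination h1 + h2
  obtain ⟨a, ha⟩ := Matrix.exists_inner_of_trace_eq_zero h2
    (φ.toLinearMap ∘ₗ DL ∘ₗ φ.symm.toLinearMap) (fun x => by
      have := hc (φ.symm x)
      simpa [t] using this)
  -- descend along a `K`-linear retraction `r` of `K → L`
  obtain ⟨r, hr⟩ := (Algebra.linearMap K L).exists_leftInverse_of_injective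
    (LinearMap.ker_eq_bot.2 (algebraMap K L).injective)
  have hr1 : r 1 = 1 := by simpa using LinearMap.congr_fun hr 1
  let ρ : L ⊗[K] B →ₗ[K] B := (TensorProduct.lid K B).toLinearMap ∘ₗ r.rTensor B
  have hρ : ∀ l b, ρ (l ⊗ₜ b) = r l • b := fun l b => by simp [ρ]
  have hρr : ∀ X b, ρ (X * (1 ⊗ₜ b)) = ρ X * b := by
    intro X b
    induction X using TensorProduct.induction_on with
    | zero => simp
    | tmul l y => simp [hρ]
    | add X Y hX hY => simp only [add_mul, map_add, hX, hY]
  have hρl : ∀ X b, ρ ((1 ⊗ₜ b) * X) = b * ρ X := by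
    intro X b
    induction X using TensorProduct.induction_on with
    | zero => simp
    | tmul l y => simp [hρ]
    | add X Y hX hY => simp only [mul_add, map_add, hX, hY]
  refine ⟨ρ (φ.symm a), fun x => ?_⟩
  have h3 : φ (1 ⊗ₜ D x) = a * φ (1 ⊗ₜ x) - φ (1 ⊗ₜ x) * a := by
    have := ha (φ (1 ⊗ₜ x))
    simpa [DL] using this
  have h4 : (1 : L) ⊗ₜ[K] D x = φ.symm a * (1 ⊗ₜ x) - (1 ⊗ₜ x) * φ.symm a := by
    apply φ.injective
    simpa using h3
  have h5 := congrArg ρ h4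
  rwa [map_sub, hρr, hρl, hρ, hr1, one_smul] at h5

end CentralSimple

/-! ### Simple quotients of `A` -/

section SimpleQuotient

variable {F A : Type*} [Field F] [NonUnitalRing A] [Module F A]

theorem eq_zero_of_mem_commutatorSpan [IsScalarTower F A A] [SMulCommClass F A A]
    {K B L : Type*} [Field K] [Ring B] [Algebra F K] [Algebra K B]
    [Algebra F B] [IsScalarTower F K B] [AddCommGroup L] [Module K L] (t : B →ₗ[K] L)
    (ht : ∀ x y, t (x * y) = t (y * x)) (π : A →ₙₐ[F] B) {u : A}
    (hu : u ∈ AssocAlg.commutatorSpan F A) : t (π u) = 0 := by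
  induction hu using Submodule.span_induction with
  | mem u hu =>
    obtain ⟨x, y, rfl⟩ := hu
    rw [map_sub, map_mul, map_mul, map_sub, ht, sub_self]
  | zero => simp
  | add u v _ _ hu hv => rw [map_add, map_add, hu, hv, add_zero]
  | smul f u _ hu => rw [map_smul, ← algebraMap_smul K, map_smul, hu, smul_zero]

/-- On a central simple quotient `π : A → B`, the map `D` induces a `K`-linear map, which is inner.
Both the descent to `B` and the `K`-linearity come from the polarized identity, in which `D y` appears
paired with arbitrary squares of `B`. -/
theorem exists_inner_of_surjective_central [IsScalarTower F A A] [SMulCommClass F A A]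
    (hF : (2 : F) ≠ 0) (D : A →ₗ[F] A)
    (hD : ∀ x : A, x * D x * x ∈ AssocAlg.commutatorSpan F A) {K B : Type*} [Field K] [Ring B]
    [Algebra F K] [Algebra K B] [Algebra F B] [IsScalarTower F K B] [IsSimpleRing B]
    [Algebra.IsCentral K B] [FiniteDimensional K B] (π : A →ₙₐ[F] B)
    (hπ : Function.Surjective π) : ∃ b : B, ∀ x, π (D x) = b * π x - π x * b := by
  obtain ⟨n, _, ⟨φ⟩⟩ := exists_splitting K B
  have h2 : (2 : AlgebraicClosure K) ≠ 0 := by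
    have := (map_ne_zero ((algebraMap K (AlgebraicClosure K)).comp (algebraMap F K))).2 hF
    rwa [map_ofNat] at this
  have hG : ∀ g : AlgebraicClosure K, g + g = 0 → g = 0 := fun g hg => by
    rw [← two_mul] at hg
    exact (mul_eq_zero.1 hg).resolve_left h2
  have P := trace_polarization hG ((splitTrace φ).toAddMonoidHom.comp (π : A →+ B))
    (fun x y => by simpa using splitTrace_mul_comm φ (π x) (π y)) D.toAddMonoidHom
    (fun x => eq_zero_of_mem_commutatorSpan (splitTrace φ) (splitTrace_mul_comm φ) π (hD x))
  simp only [AddMonoidHom.comp_apply, LinearMap.toAddMonoidHom_coe, AddMonoidHom.coe_coe,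
    map_mul, map_add] at P
  -- squares span `B`, so pairing with them is enough
  have hsq : ∀ b : B, (∀ y : B, splitTrace φ (y * y * b) = 0) → b = 0 := by
    intro b hb
    refine eq_zero_of_splitTrace_mul_eq_zero φ b fun y => hG _ ?_
    have h1 := hb (y + 1)
    have h2 := hb y
    have h3 := hb 1
    simp only [mul_add, add_mul, one_mul, mul_one, map_add] at h1 h2 h3
    rwa [h2, h3, zero_add, add_zero] at h1
  have hker : ∀ y, π y = 0 → π (D y) = 0 := by
    intro y hy
    refine hsq _ fun b => ?_
    obtain ⟨x, rfl⟩ := hπ b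
    simpa [hy] using P x y
  have hdesc : ∀ x y, π x = π y → π (D x) = π (D y) := by
    intro x y hxy
    rw [← sub_eq_zero, ← map_sub, ← map_sub]
    exact hker _ (by rw [map_sub, hxy, sub_self])
  choose s hs using hπ
  have hK : ∀ (k : K) (b : B), π (D (s (k • b))) = k • π (D (s b)) := by
    intro k b
    rw [← sub_eq_zero]
    refine hsq _ fun y => ?_
    have h1 := P (s y) (s (k • b))
    have h2 := P (s y) (s b)
    simp only [hs] at h1 h2
    rw [mul_smul_comm, map_smul, Algebra.smul_def] at h1
    rw [mul_sub, map_sub, mul_smul_comm, map_smul (splitTrace φ),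
      Algebra.smul_def (A := AlgebraicClosure K)]
    linear_combination h1 - algebraMap K (AlgebraicClosure K) k * h2
  let DB : B →ₗ[K] B :=
    { toFun := fun b => π (D (s b))
      map_add' := fun b c => by
        rw [← map_add, ← map_add]
        exact hdesc _ _ (by rw [map_add, hs, hs, hs])
      map_smul' := hK }
  obtain ⟨b, hb⟩ := exists_inner_of_splitTrace_eq_zero φ h2 DB (fun x => by
    have := eq_zero_of_mem_commutatorSpan (splitTrace φ) (splitTrace_mul_comm φ) π (hD (s x))
    simpa [hs, DB] using this)
  refine ⟨b, fun x => ?_⟩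
  rw [← hb]
  exact hdesc _ _ (hs _).symm

/-- The case of a matrix algebra over a division algebra `Δ`, viewed as central simple over the centre
of `Δ`; this centre may be larger than `F`, and inseparable over it. -/
theorem exists_inner_of_surjective_matrix [IsScalarTower F A A] [SMulCommClass F A A]
    (hF : (2 : F) ≠ 0) (D : A →ₗ[F] A)
    (hD : ∀ x : A, x * D x * x ∈ AssocAlg.commutatorSpan F A) {Δ n : Type*} [DivisionRing Δ]
    [Algebra F Δ] [FiniteDimensional F Δ] [Fintype n] [DecidableEq n] [Nonempty n]
    (π : A →ₙₐ[F] Matrix n n Δ) (hπ : Function.Surjective π) :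
    ∃ b : Matrix n n Δ, ∀ x, π (D x) = b * π x - π x * b := by
  let K := Subring.center Δ
  let _ : Algebra K Δ := RingHom.toAlgebra' K.subtype fun c x =>
    (Subring.mem_center_iff.1 c.2 x).symm
  let _ : Algebra F K := RingHom.toAlgebra ((algebraMap F Δ).codRestrict K fun f =>
    Subring.mem_center_iff.2 fun x => (Algebra.commutes f x).symm)
  have : IsScalarTower F K Δ := .of_algebraMap_eq fun _ => rfl
  have : Algebra.IsCentral K Δ := ⟨fun x hx =>
    ⟨⟨x, Subring.mem_center_iff.2 fun y => Subalgebra.mem_center_iff.1 hx y⟩, rfl⟩⟩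
  have : FiniteDimensional K Δ := FiniteDimensional.right F K Δ
  exact exists_inner_of_surjective_central hF D hD (K := K) π hπ

end SimpleQuotient

/-! ### The unitization and the radical -/

section Radical

variable {F A : Type*} [Field F] [NonUnitalRing A] [Module F A]

theorem foldl_mem_pow {R : Type*} [Ring R] [Module F R] (J : Ideal R) (f : A →ₙₐ[F] R) (l : List A)
    (hl : ∀ c ∈ l, f c ∈ J) (k : ℕ) (b : A) (hb : f b ∈ J ^ (k + 1)) :
    f (l.foldl (· * ·) b) ∈ J ^ (k + 1 + l.length) := by
  induction l generalizing k b with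
  | nil => simpa using hb
  | cons u l ih =>
    rw [List.foldl_cons, List.length_cons, add_comm l.length, ← add_assoc]
    refine ih (fun c h => hl c (by simp [h])) _ _ ?_
    rw [map_mul, Submodule.pow_succ]
    exact Ideal.mul_mem_mul hb (hl u (by simp))

theorem finiteDimensional_unitization [FiniteDimensional F A] :
    FiniteDimensional F (Unitization F A) :=
  Module.Finite.equiv (Unitization.linearEquiv F F A).symm

/-- `A` is an ideal of its unitization: `r * x` lies in `A` for `x : A`. -/
theorem inr_snd_mul_inr (r : Unitization F A) (x : A) :
    ((r * (x : Unitization F A)).snd : Unitization F A) = r * (x : Unitization F A) := by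
  ext <;> simp

/-- `A` is an ideal of its unitization: `x * r` lies in `A` for `x : A`. -/
theorem inr_snd_inr_mul (r : Unitization F A) (x : A) :
    (((x : Unitization F A) * r).snd : Unitization F A) = (x : Unitization F A) * r := by
  ext <;> simp

variable [IsScalarTower F A A] [SMulCommClass F A A]

/-- `A ∩ J` is a nilpotent ideal of `A`, where `J` is the Jacobson radical of the unitization. -/
theorem mem_radical_of_inr_mem_jacobson [FiniteDimensional F A] {x : A}
    (hx : (x : Unitization F A) ∈ Ring.jacobson (Unitization F A)) : x ∈ AssocAlg.radical F A := by
  have hfin : FiniteDimensional F (Unitization F A) := finiteDimensional_unitization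
  have hart : IsArtinianRing (Unitization F A) := IsArtinianRing.of_finite F _
  let I : Submodule F A := ((Ring.jacobson (Unitization F A)).restrictScalars F).comap
    (Unitization.inrHom F F A)
  have hI : ∀ x, x ∈ I ↔ (x : Unitization F A) ∈ Ring.jacobson (Unitization F A) := fun _ => Iff.rfl
  have hle : I ≤ AssocAlg.radical F A := by
    refine le_sSup ⟨fun x hx a => ?_, ?_⟩
    · rw [hI] at hx ⊢
      rw [hI, Unitization.inr_mul, Unitization.inr_mul]
      exact ⟨Ideal.mul_mem_left _ _ hx, Ideal.mul_mem_right _ _ hx⟩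
    · obtain ⟨m, hm⟩ := IsSemiprimaryRing.isNilpotent (R := Unitization F A)
      refine ⟨m, fun b hb l hl hc => ?_⟩
      have := foldl_mem_pow (Ring.jacobson (Unitization F A))
        (Unitization.inrNonUnitalAlgHom F A) l (fun c h => hc c h) 0 b (by
          rw [zero_add, Submodule.pow_one]
          exact hb)
      have := Ideal.pow_le_pow_right (by omega : m ≤ 0 + 1 + l.length) this
      rw [hm] at this
      exact Unitization.inr_injective (R := F) (by simpa using this)
  exact hle hx

end Radical

/-! ### Gluing over the simple factors -/

theorem theorem2p2 {F A : Type*} [Field F] [NonUnitalRing A] [Module F A]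
    [IsScalarTower F A A] [SMulCommClass F A A] [FiniteDimensional F A]
    (hF : ringChar F ≠ 2) (D : A →ₗ[F] A)
    (hD : ∀ x : A, x * D x * x ∈ AssocAlg.commutatorSpan F A) :
    ∃ (a : A) (N : A →ₗ[F] A), (∀ x : A, N x ∈ AssocAlg.radical F A) ∧
      D = AssocAlg.innerDerivation F a + N := by
  classical
  have hfin : FiniteDimensional F (Unitization F A) := finiteDimensional_unitization
  have hart : IsArtinianRing (Unitization F A) := IsArtinianRing.of_finite F _
  let R := Unitization F A
  let J := Ring.jacobson R
  obtain ⟨m, Δ, d, _, _, _, hd, ⟨e⟩⟩ :=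
    IsSemisimpleRing.exists_algEquiv_pi_matrix_divisionRing_finite F (R ⧸ J)
  let q : R →ₐ[F] Π i, Matrix (Fin (d i)) (Fin (d i)) (Δ i) :=
    e.toAlgHom.comp (Ideal.Quotient.mkₐ F J)
  have hq : Function.Surjective q := e.surjective.comp (Ideal.Quotient.mkₐ_surjective F J)
  have hqJ : ∀ r, q r = 0 → r ∈ J := fun r hr => by
    rw [← Ideal.Quotient.eq_zero_iff_mem]
    exact e.injective (by simpa [q] using hr)
  let π : ∀ i, A →ₙₐ[F] Matrix (Fin (d i)) (Fin (d i)) (Δ i) := fun i =>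
    ((Pi.evalAlgHom F (fun i => Matrix (Fin (d i)) (Fin (d i)) (Δ i)) i).comp q :
      R →ₙₐ[F] Matrix (Fin (d i)) (Fin (d i)) (Δ i)).comp (Unitization.inrNonUnitalAlgHom F A)
  have hπ : ∀ i x, π i x = q (x : R) i := fun _ _ => rfl
  -- `[a, ·]` implements `D` on the `i`-th factor, and `a` vanishes on the others; on a factor where `A`
  -- has zero image, `a = 0` will do
  have key : ∀ i, ∃ a : A, (∀ x, π i (D x) = π i a * π i x - π i x * π i a) ∧
      ∀ j, j ≠ i → π j a = 0 := by
    intro i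
    by_cases h0 : ∀ x, π i x = 0
    · exact ⟨0, by simp [h0], by simp⟩
    -- the image of `A` is a nonzero two-sided ideal of a simple ring
    have hsurj : Function.Surjective (π i) := by
      let I : TwoSidedIdeal (Matrix (Fin (d i)) (Fin (d i)) (Δ i)) :=
        .mk' (Set.range (π i)) ⟨0, map_zero _⟩
          (by rintro _ _ ⟨x, rfl⟩ ⟨y, rfl⟩; exact ⟨x + y, map_add _ _ _⟩)
          (by rintro _ ⟨x, rfl⟩; exact ⟨-x, map_neg _ _⟩)
          (by
            rintro b _ ⟨x, rfl⟩
            obtain ⟨r, hr⟩ := hq (Pi.single i b)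
            refine ⟨(r * (x : R)).snd, ?_⟩
            rw [hπ, inr_snd_mul_inr, map_mul, hr, Pi.mul_apply, Pi.single_eq_same, hπ])
          (by
            rintro _ b ⟨x, rfl⟩
            obtain ⟨r, hr⟩ := hq (Pi.single i b)
            refine ⟨((x : R) * r).snd, ?_⟩
            rw [hπ, inr_snd_inr_mul, map_mul, hr, Pi.mul_apply, Pi.single_eq_same, hπ])
      push Not at h0
      obtain ⟨x, hx⟩ := h0
      have h1 : (1 : Matrix (Fin (d i)) (Fin (d i)) (Δ i)) ∈ I :=
        IsSimpleRing.one_mem_of_ne_zero_mem I hx ((TwoSidedIdeal.mem_mk' ..).2 ⟨x, rfl⟩)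
      intro b
      have := I.mul_mem_left b _ h1
      rw [mul_one] at this
      obtain ⟨x, hx⟩ := (TwoSidedIdeal.mem_mk' _ _ _ _ _ _ _).1 this
      exact ⟨x, hx⟩
    obtain ⟨b, hb⟩ := exists_inner_of_surjective_matrix (Ring.two_ne_zero hF) D hD (π i) hsurj
    -- multiplying a preimage of `b` by a lift of the `i`-th central idempotent kills the other factors
    -- and stays in the ideal `A`
    obtain ⟨x, hx⟩ := hsurj b
    obtain ⟨r, hr⟩ := hq (Pi.single i 1)
    have hrx : ∀ j, π j (r * (x : R)).snd = q r j * π j x := by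
      intro j
      rw [hπ, inr_snd_mul_inr, map_mul, Pi.mul_apply, hπ]
    refine ⟨(r * (x : R)).snd, fun y => ?_, fun j hj => ?_⟩
    · rw [hrx, hr, Pi.single_eq_same, one_mul, hx, hb]
    · rw [hrx, hr, Pi.single_eq_of_ne hj, zero_mul]
  choose a ha ha0 using key
  have hsum : ∀ i, π i (∑ j, a j) = π i (a i) := by
    intro i
    rw [map_sum, Finset.sum_eq_single i (fun j _ hj => ha0 j i hj.symm) (by simp)]
  refine ⟨∑ i, a i, D - AssocAlg.innerDerivation F (∑ i, a i), fun x => ?_, by abel⟩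
  apply mem_radical_of_inr_mem_jacobson
  apply hqJ
  ext1 i
  rw [← hπ, LinearMap.sub_apply, map_sub, ha]
  simp [AssocAlg.innerDerivation, hsum]
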